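/- Let $G$ be an undirected graph on the players $[n]$, with (non-inclusive) neighbor sets $\mathcal N(i)$. A graphical game with graph $G$ has finite non-empty action sets $A_i$, with $A=\prod_i A_i$ and $A_S=\prod_{j\in S}A_j$, and payoff functions $M_i(x)=M'_i(x_i,x_{\mathcal N(i)})$. A preference-order-preserving transform for player $i$ is a function $f_i:\mathbb R\times A_{\mathcal N(i)}\to\mathbb R$ that is strictly increasing in its first argument; an inverse of it is a function $f_i^{-1}:\mathbb R\times A_{\mathcal N(i)}\to\mathbb R$ with $f_i^{-1}(f_i(v,y),y)=v$ for all $v,y$. Given transforms $f=(f_i)$, the game is an $f$-transformed (Gibbs-)potential game with potential $\Psi:A\to\mathbb R$ if, for all $i,x_i,x_i',x_{-i}$, $$M'_i(x_i,x_{\mathcal N(i)})-M'_i(x'_i,x_{\mathcal N(i)})=f_i\bigl(\Psi(x_i,x_{-i})-\Psi(x'_i,x_{-i}),\,x_{\mathcal N(i)}\bigr);$$ it is a $w$-weighted (Gibbs-)potential game, $w_i>0$, if this holds with $f_i(v,\cdot)=w_iv$. A Markov playing procedure gives each player $i$ a conditional distribution $p_i(\cdot\mid x_{-i})$ on $A_i$;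 it is local if each $p_i$ depends on $x_{-i}$ only through $x_{\mathcal N(i)}$. In the sequential process of play, started from a joint action $x^0$, the players move one at a time in the order $1,\dots,n,1,\dots,n,\dots$, and the mover $i$ draws a new action from $p_i(\cdot\mid x_{-i})$, where $x_{-i}$ are the last actions of the others. Let $z^r\in A$ be the joint action formed by the moves of round $r$ (the $r$-th block of $n$ moves), and $\widehat P^T(x)=\frac1T\sum_{r=1}^T\mathbf 1[z^r=x]$. The procedure is consistent if there is one probability distribution $P$ on $A$ such that, from every $x^0$, almost surely $\widehat P^T(x)\to P(x)$ for all $x$. For preference-order-preserving transforms $h=(h_i)$, the procedure is SBR with respect to $h$ if $p_i(x_i\mid x_{-i})\propto\exp\bigl(h_i(M'_i(x_i,x_{\mathcal N(i)}),x_{\mathcal N(i)})\bigr)$ (as functions of $x_i$), and SBRD with respect to $h$ if $$\frac{p_i(x_i\mid x_{-i})}{p_i(x'_i\mid x_{-i})}=\exp\bigl(h_i(M'_i(x_i,x_{\mathcal N(i)})-M'_i(x'_i,x_{\mathcal N(i)}),\,x_{\mathcal N(i)})\bigr).$$ **Proposition.** 1. Let the game be an $f$-transformed Gibbs-potential game with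 graph $G$ and potential $\Psi$, where $f$ are preference-order-preserving transforms, and let $f^{-1}$ be inverses of $f$. Then $\Psi$ is a Gibbs potential with respect to $G$, that is, $\Psi(x)=\sum_C\phi_C(x_C)$ for some functions $\phi_C:A_C\to\mathbb R$ indexed by the maximal cliques $C$ of $G$. The game has a consistent, local Markov SBRD playing procedure in which the players use the inverse transforms $f^{-1}$: it is SBRD with respect to preference-order-preserving transforms $h_i$ that equal $f_i^{-1}$ at every $(v,y)$ where $v=M'_i(a,y)-M'_i(b,y)$ is a payoff difference, and $h_i=f_i^{-1}$ everywhere if every $f_i(\cdot,y)$ maps onto $\mathbb R$. From every $x^0$, its empirical play converges almost surely to the Gibbs distribution $P(x)=\exp(\Psi(x))/\sum_{x'}\exp(\Psi(x'))$. 2. If the game is a $w$-weighted Gibbs-potential game with graph $G$ and potential $\Psi$, then again $\Psi$ is a Gibbs potential with respect to $G$, and the game also has a consistent, local Markov SBR playing procedure with respect to the linear transforms of weight $1/w_i$, i.e. $p_i(x_i\mid x_{-i})\propto\exp(M'_i(x_i,x_{\mathcal N(i)})/w_i)$, whose empirical play converges almost surely, from every $x^0$, to the same Gibbs distribution. -/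

import Mathlib

open MeasureTheory ProbabilityTheory Filter Topology

noncomputable section

namespace GraphicalPotential

/-- Joint actions `x = (x_1, ..., x_n)`; the players are the elements of `Fin n`. -/
abbrev Joint {n : ℕ} (A : Fin n → Type*) := ∀ i, A i

/-- Joint actions `x_{-i}` of all the players except `i`. -/
abbrev Others {n : ℕ} (A : Fin n → Type*) (i : Fin n) := ∀ j : {j : Fin n // j ≠ i}, A j

/-- Joint actions `x_{𝓝(i)}` of the neighbors of `i` (not including `i`). -/
abbrev Nbrs {n : ℕ} (A : Fin n → Type*) (G : SimpleGraph (Fin n)) (i : Fin n) :=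
  ∀ j : {j : Fin n // G.Adj i j}, A j

/-- The part `x_{-i}` of a joint action `x`. -/
def Joint.others {n : ℕ} {A : Fin n → Type*} (x : Joint A) (i : Fin n) : Others A i :=
  fun j => x j

/-- The part `x_{𝓝(i)}` of a joint action `x`. -/
def Joint.nbrs {n : ℕ} {A : Fin n → Type*} (G : SimpleGraph (Fin n)) (x : Joint A) (i : Fin n) :
    Nbrs A G i :=
  fun j => x j

/-- The part `x_{𝓝(i)}` of `x_{-i}`. -/
def Others.nbrs {n : ℕ} {A : Fin n → Type*} (G : SimpleGraph (Fin n)) {i : Fin n}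
    (y : Others A i) : Nbrs A G i :=
  fun j => y ⟨j, j.2.ne'⟩

/-- A graphical game with graph `G`: for each player `i` a local payoff hypermatrix
`M'_i (x_i, x_{𝓝(i)})`. The payoff function of `i` is `M_i(x) = M'_i (x_i, x_{𝓝(i)})`. -/
structure GraphicalGame {n : ℕ} (A : Fin n → Type*) (G : SimpleGraph (Fin n)) where
  /-- the local payoff hypermatrices -/
  payoff : ∀ i, A i → Nbrs A G i → ℝ

/-- Families of functions `f_i : ℝ × A_{𝓝(i)} → ℝ`, one for each player. -/
abbrev Transforms {n : ℕ} (A : Fin n → Type*) (G : SimpleGraph (Fin n)) :=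
  ∀ i, ℝ → Nbrs A G i → ℝ

section Potentials

variable {n : ℕ} {A : Fin n → Type*} {G : SimpleGraph (Fin n)}

/-- `f_i` is a (conditional) preference-order-preserving transform: strictly increasing in `v`,
for every joint action of the neighbors. -/
def IsPreferenceOrderPreserving {i : Fin n} (fi : ℝ → Nbrs A G i → ℝ) : Prop :=
  ∀ y : Nbrs A G i, StrictMono fun v => fi v y

/-- `g = f⁻¹`: each `g_i` is a (conditional) inverse function of `f_i`. -/
def IsInverseOf (g f : Transforms A G) : Prop :=
  ∀ i v y, g i (f i v y) y = v

/-- The (unconditionally) linear transforms `f_i(v, x_{𝓝(i)}) = w_i v`. -/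
def linearTransforms (A : Fin n → Type*) (G : SimpleGraph (Fin n)) (w : Fin n → ℝ) :
    Transforms A G :=
  fun i v _ => w i * v

/-- `Ψ` is an `f`-transformed potential of the game:
`M'_i(a, x_{𝓝(i)}) - M'_i(b, x_{𝓝(i)}) = f_i(Ψ(a, x_{-i}) - Ψ(b, x_{-i}), x_{𝓝(i)})`. -/
def IsTransformedPotential (M : GraphicalGame A G) (f : Transforms A G) (Ψ : Joint A → ℝ) : Prop :=
  ∀ (i : Fin n) (x : Joint A) (a b : A i),
    M.payoff i a (x.nbrs G i) - M.payoff i b (x.nbrs G i) =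
      f i (Ψ (Function.update x i a) - Ψ (Function.update x i b)) (x.nbrs G i)

/-- `Ψ` is a (weighted) `w`-potential of the game. -/
def IsWeightedPotential (M : GraphicalGame A G) (w : Fin n → ℝ) (Ψ : Joint A → ℝ) : Prop :=
  IsTransformedPotential M (linearTransforms A G w) Ψ

open Classical in
/-- `Ψ` is a Gibbs potential with respect to `G`: a sum `∑_C φ_C(x_C)` of local potential functions
over the maximal cliques `C` of `G`. -/
def IsGibbsPotential (G : SimpleGraph (Fin n)) (Ψ : Joint A → ℝ) : Prop :=
  ∃ φ : ∀ C : Finset (Fin n), (∀ j : C, A j) → ℝ, ∀ x : Joint A,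
    Ψ x = ∑ C : Finset (Fin n) with Maximal (fun s : Finset (Fin n) => G.IsClique (s : Set (Fin n))) C,
      φ C (fun j => x j)

/-- The probability distribution proportional to `exp Ψ`. -/
def gibbs [∀ i, Fintype (A i)] (Ψ : Joint A → ℝ) (x : Joint A) : ℝ :=
  Real.exp (Ψ x) / ∑ y : Joint A, Real.exp (Ψ y)

end Potentials

/-- A Markov playing procedure: for each player `i`, a (time-homogeneous, first-order) Markov playing
scheme, i.e. a conditional probability distribution `p_i(· | x_{-i})` on the actions of `i`. -/
abbrev MarkovProcedure {n : ℕ} (A : Fin n → Type*) := ∀ i, Others A i → PMF (A i)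

section Schemes

variable {n : ℕ} {A : Fin n → Type*} {G : SimpleGraph (Fin n)}

/-- The procedure is local with respect to `G`: the scheme of each player depends only on the
last actions of its neighbors. -/
def IsLocal (G : SimpleGraph (Fin n)) (p : MarkovProcedure A) : Prop :=
  ∀ i, ∃ q : Nbrs A G i → PMF (A i), ∀ y : Others A i, p i y = q (y.nbrs G)

/-- SBR playing procedure with respect to the transforms `f`: each `f_i` is
preference-order-preserving and `p_i(a | x_{-i}) ∝ exp (f_i(M_i(a, x_{-i}), x_{𝓝(i)}))`. -/
def IsSBR (M : GraphicalGame A G) (p : MarkovProcedure A) (f : Transforms A G) : Prop :=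
  ∀ i, IsPreferenceOrderPreserving (f i) ∧
    ∀ y : Others A i, ∃ c : ℝ, ∀ a : A i,
      (p i y a).toReal = c * Real.exp (f i (M.payoff i a (y.nbrs G)) (y.nbrs G))

/-- SBRD playing procedure with respect to the transforms `f`: each `f_i` is
preference-order-preserving and
`p_i(a | x_{-i}) / p_i(b | x_{-i}) = exp (f_i(M_i(a, x_{-i}) - M_i(b, x_{-i}), x_{𝓝(i)}))`.
(The right-hand side is positive, so all these probabilities are nonzero.) -/
def IsSBRD (M : GraphicalGame A G) (p : MarkovProcedure A) (f : Transforms A G) : Prop :=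
  ∀ i, IsPreferenceOrderPreserving (f i) ∧
    ∀ (y : Others A i) (a b : A i),
      (p i y a).toReal / (p i y b).toReal =
        Real.exp (f i (M.payoff i a (y.nbrs G) - M.payoff i b (y.nbrs G)) (y.nbrs G))

end Schemes

section Play

variable {n : ℕ} {A : Fin n → Type*}

/-- One time step of the sequential process of play. The state `x` is the joint action formed by
the last actions of the players. At the step from time `t` to time `t + 1` only one player `i` moves,
the players taking turns in the order `0, 1, ..., n - 1, 0, 1, ...`, and `i` draws its new action
from `p_i(· | x_{-i})`. (With no players, nothing happens.) -/
def playStep (p : MarkovProcedure A) (t : ℕ) (x : Joint A) : PMF (Joint A) :=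
  if h : 0 < n then
    (p ⟨t % n, Nat.mod_lt t h⟩ (x.others _)).map (Function.update x ⟨t % n, Nat.mod_lt t h⟩)
  else PMF.pure x

variable [∀ i, Finite (A i)] [∀ i, MeasurableSpace (A i)] [∀ i, MeasurableSingletonClass (A i)]

/-- The transition kernel at time `t`, as a function of the history of states up to time `t`. -/
def playKernel (p : MarkovProcedure A) (t : ℕ) :
    Kernel (∀ _ : Finset.Iic t, Joint A) (Joint A) :=
  (Kernel.ofFunOfCountable fun x : Joint A => (playStep p t x).toMeasure).comap
    (fun h => h ⟨t, Finset.mem_Iic.2 le_rfl⟩) (measurable_pi_apply _)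

instance (p : MarkovProcedure A) (t : ℕ) : IsMarkovKernel (playKernel p t) :=
  ⟨fun h => by
    change IsProbabilityMeasure (playStep p t (h ⟨t, Finset.mem_Iic.2 le_rfl⟩)).toMeasure
    infer_instance⟩

/-- The law of the sequence of states `ω 0, ω 1, ω 2, ...` of the sequential process of play,
started from the joint action `x₀`. -/
def playLaw (p : MarkovProcedure A) (x₀ : Joint A) : Measure (ℕ → Joint A) :=
  Kernel.traj (X := fun _ => Joint A) (playKernel p) 0 (fun _ => x₀)

/-- The play outcome of round `r` (rounds are counted from `0`): the joint action whose component
`i` is the action that player `i` chooses when it moves in that round, at time `r n + i + 1`. -/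
def outcome (ω : ℕ → Joint A) (r : ℕ) : Joint A :=
  fun i => ω (r * n + i + 1) i

/-- The empirical distribution of play after `T` rounds. -/
def empirical (ω : ℕ → Joint A) (T : ℕ) (x : Joint A) : ℝ :=
  (∑ r ∈ Finset.range T, Set.indicator {x} (fun _ => (1 : ℝ)) (outcome ω r)) / T

/-- Started from `x₀`, the empirical distribution of play converges almost surely to `P`. -/
def PlayConvergesTo (p : MarkovProcedure A) (x₀ : Joint A) (P : Joint A → ℝ) : Prop :=
  ∀ᵐ ω ∂(playLaw p x₀), ∀ x, Tendsto (fun T => empirical ω T x) atTop (𝓝 (P x))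

end Play

/-- The procedure is consistent (globally convergent): the empirical play converges to the same
joint probability distribution from any initial joint play. -/
def IsConsistent {n : ℕ} {A : Fin n → Type*} [∀ i, Fintype (A i)] [∀ i, MeasurableSpace (A i)]
    [∀ i, MeasurableSingletonClass (A i)] (p : MarkovProcedure A) : Prop :=
  ∃ P ∈ stdSimplex ℝ (Joint A), ∀ x₀, PlayConvergesTo p x₀ P

end GraphicalPotential

end

open GraphicalPotential

/-! Applying the inverse transform to the potential identity shows that the change of `Ψ` under a
deviation of player `i` is a function of the two actions and of the neighbors' actions alone. Both
halves of the result follow from this locality.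

Locality of differences is the hypothesis of the additive Hammersley–Clifford theorem
(`HasLocalDifferences.isGibbsPotential`). It also yields local utilities `V i` with the same
differences as `Ψ`; their softmax responses are exactly the conditional laws of `gibbs Ψ`, so play
is a Gibbs sampler with cyclic scan (`IsLocalUtility.isGibbsSampler`). In the weighted case `V i` is
the payoff divided by `w i`.

For convergence, let `K` be the expectation operator of one round. It preserves `gibbs Ψ`, and since
every action has positive probability, the maximum principle makes its fixed functions constant.
Hence `g - K g = φ - c`, with `c` the Gibbs mean of `φ`, has a solution `g` (`exists_poisson`). Sums
of `φ` over rounds are then `T * c` plus a bounded boundary term plus a martingale with bounded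
increments, which is `o(T)` by Chernoff bounds and Borel–Cantelli. -/

/-! ### Strong law for bounded martingale differences -/

namespace ProbabilityTheory.Kernel

open Preorder

variable {X : ℕ → Type*} [∀ t, MeasurableSpace (X t)]
  {κ : (t : ℕ) → Kernel (∀ i : Finset.Iic t, X i) (X (t + 1))} [∀ t, IsMarkovKernel (κ t)]

/-- The conditional law of the state at time `t + 1` given the history up to time `t` is `κ t`. -/
theorem lintegral_traj_succ (x₀ : ∀ i : Finset.Iic 0, X i) (t : ℕ)
    {F : (∀ i : Finset.Iic t, X i) → X (t + 1) → ENNReal} (hF : Measurable (Function.uncurry F)) :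
    ∫⁻ ω, F (frestrictLe t ω) (ω (t + 1)) ∂traj κ 0 x₀ =
      ∫⁻ ω, ∫⁻ x, F (frestrictLe t ω) x ∂κ t (frestrictLe t ω) ∂traj κ 0 x₀ := by
  have h1 := MeasureTheory.lintegral_map (μ := traj κ 0 x₀) hF
    (g := fun ω : (∀ t, X t) => (frestrictLe t ω, ω (t + 1))) (by fun_prop)
  rw [← partialTraj_compProd_eq_map_traj (Nat.zero_le t), Measure.lintegral_compProd hF,
    ← traj_map_frestrictLe_apply, MeasureTheory.lintegral_map (hF.lintegral_kernel_prod_right') (by fun_prop)] at h1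
  exact h1.symm

/-- The sum of the observables `d t` of the first `T` transitions of a trajectory. -/
def transitionSum (d : ∀ t, (∀ i : Finset.Iic t, X i) → X (t + 1) → ℝ) (T : ℕ) (ω : ∀ t, X t) : ℝ :=
  ∑ t ∈ Finset.range T, d t (frestrictLe t ω) (ω (t + 1))

variable {d : ∀ t, (∀ i : Finset.Iic t, X i) → X (t + 1) → ℝ}

theorem transitionSum_eq_comp_frestrictLe (hd : ∀ t, Measurable (Function.uncurry (d t))) (T : ℕ) :
    ∃ F : (∀ i : Finset.Iic T, X i) → ℝ, Measurable F ∧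
      ∀ ω, transitionSum d T ω = F (frestrictLe T ω) := by
  induction T with
  | zero => exact ⟨fun _ => 0, measurable_const, fun ω => by simp [transitionSum]⟩
  | succ T ih =>
    obtain ⟨F, hF, h⟩ := ih
    refine ⟨fun y => F (frestrictLe₂ (Nat.le_succ T) y) +
      Function.uncurry (d T) (frestrictLe₂ (Nat.le_succ T) y, y ⟨T + 1, Finset.mem_Iic.2 le_rfl⟩),
      ?_, fun ω => ?_⟩
    · exact (hF.comp (by fun_prop)).add ((hd T).comp (by fun_prop))
    · simp only [transitionSum, Finset.sum_range_succ] at h ⊢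
      rw [h]
      rfl

/-- From `exp s ≤ 1 + s + s ^ 2` for `|s| ≤ 1`: the linear term has mean zero, and `1 + u ≤ exp u`
closes the estimate. -/
theorem lintegral_exp_le_of_integral_eq_zero {Ω : Type*} [MeasurableSpace Ω] {μ : Measure Ω}
    [IsProbabilityMeasure μ] {D : Ω → ℝ} (hD : Measurable D) {C l : ℝ} (hb : ∀ ω, |D ω| ≤ C)
    (h0 : ∫ ω, D ω ∂μ = 0) (hl : |l| * C ≤ 1) :
    ∫⁻ ω, ENNReal.ofReal (Real.exp (l * D ω)) ∂μ ≤ ENNReal.ofReal (Real.exp (l ^ 2 * C ^ 2)) := by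
  have hint : Integrable D μ := Integrable.of_bound hD.aestronglyMeasurable C (ae_of_all _ hb)
  have hle : ∀ ω, Real.exp (l * D ω) ≤ 1 + l * D ω + l ^ 2 * C ^ 2 := fun ω => by
    have h1 : |l * D ω| ≤ 1 := by
      rw [abs_mul]
      exact (mul_le_mul_of_nonneg_left (hb ω) (abs_nonneg l)).trans hl
    have h2 := (abs_le.1 (Real.abs_exp_sub_one_sub_id_le h1)).2
    have h3 : D ω ^ 2 ≤ C ^ 2 := sq_le_sq' (abs_le.1 (hb ω)).1 (abs_le.1 (hb ω)).2
    nlinarith [mul_le_mul_of_nonneg_left h3 (sq_nonneg l)]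
  have hint' : Integrable (fun ω => 1 + l * D ω + l ^ 2 * C ^ 2) μ :=
    ((integrable_const _).add (hint.const_mul l)).add (integrable_const _)
  calc ∫⁻ ω, ENNReal.ofReal (Real.exp (l * D ω)) ∂μ
      ≤ ∫⁻ ω, ENNReal.ofReal (1 + l * D ω + l ^ 2 * C ^ 2) ∂μ :=
        lintegral_mono fun ω => ENNReal.ofReal_le_ofReal (hle ω)
    _ = ENNReal.ofReal (∫ ω, (1 + l * D ω + l ^ 2 * C ^ 2) ∂μ) :=
        (ofReal_integral_eq_lintegral_ofReal hint'
          (ae_of_all _ fun ω => (Real.exp_pos _).le.trans (hle ω))).symm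
    _ = ENNReal.ofReal (1 + l ^ 2 * C ^ 2) := by
        rw [integral_add (f := fun ω => 1 + l * D ω) (g := fun _ => l ^ 2 * C ^ 2)
          ((integrable_const _).add (hint.const_mul l)) (integrable_const _),
          integral_add (integrable_const _) (hint.const_mul l), integral_const_mul, h0]
        simp
    _ ≤ _ := ENNReal.ofReal_le_ofReal (by linarith [Real.add_one_le_exp (l ^ 2 * C ^ 2)])

/-- Conditioning on the history up to time `T` freezes the earlier sum, and the last increment
contributes one more factor by the one-step bound. -/
theorem lintegral_exp_transitionSum_le (hd : ∀ t, Measurable (Function.uncurry (d t))) {C l : ℝ}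
    (hb : ∀ t y x, |d t y x| ≤ C) (h0 : ∀ t y, ∫ x, d t y x ∂κ t y = 0) (hl : |l| * C ≤ 1)
    (x₀ : ∀ i : Finset.Iic 0, X i) (T : ℕ) :
    ∫⁻ ω, ENNReal.ofReal (Real.exp (l * transitionSum d T ω)) ∂traj κ 0 x₀ ≤
      ENNReal.ofReal (Real.exp (l ^ 2 * C ^ 2)) ^ T := by
  induction T with
  | zero => simp [transitionSum]
  | succ T ih =>
    obtain ⟨F, hF, h⟩ := transitionSum_eq_comp_frestrictLe hd T
    have hdT := hd T
    calc ∫⁻ ω, ENNReal.ofReal (Real.exp (l * transitionSum d (T + 1) ω)) ∂traj κ 0 x₀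
        = ∫⁻ ω, (fun y x => ENNReal.ofReal (Real.exp (l * F y)) *
            ENNReal.ofReal (Real.exp (l * d T y x))) (frestrictLe T ω) (ω (T + 1)) ∂traj κ 0 x₀ := by
          refine lintegral_congr fun ω => ?_
          simp only [← h]
          rw [← ENNReal.ofReal_mul (Real.exp_pos _).le, ← Real.exp_add, ← mul_add]
          simp [transitionSum, Finset.sum_range_succ]
      _ = ∫⁻ ω, ENNReal.ofReal (Real.exp (l * transitionSum d T ω)) *
            ∫⁻ x, ENNReal.ofReal (Real.exp (l * d T (frestrictLe T ω) x))
              ∂κ T (frestrictLe T ω) ∂traj κ 0 x₀ := by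
          refine (lintegral_traj_succ (κ := κ) (F := fun y x => ENNReal.ofReal (Real.exp (l * F y)) *
            ENNReal.ofReal (Real.exp (l * d T y x))) x₀ T ?_).trans ?_
          · exact ((((hF.comp measurable_fst).const_mul l).exp).ennreal_ofReal).mul
              (((hdT.const_mul l).exp).ennreal_ofReal)
          · refine lintegral_congr fun ω => ?_
            rw [lintegral_const_mul, h]
            exact (((hdT.comp measurable_prodMk_left).const_mul l).exp).ennreal_ofReal
      _ ≤ ∫⁻ ω, ENNReal.ofReal (Real.exp (l * transitionSum d T ω)) *
            ENNReal.ofReal (Real.exp (l ^ 2 * C ^ 2)) ∂traj κ 0 x₀ := by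
          refine lintegral_mono fun ω => mul_le_mul_right ?_ _
          exact lintegral_exp_le_of_integral_eq_zero (hdT.comp measurable_prodMk_left)
            (hb T _) (h0 T _) hl
      _ ≤ _ := by
          rw [lintegral_mul_const' _ _ ENNReal.ofReal_ne_top, pow_succ]
          exact mul_le_mul_left ih _

theorem measurable_transitionSum (hd : ∀ t, Measurable (Function.uncurry (d t))) (T : ℕ) :
    Measurable (transitionSum d T) := by
  obtain ⟨F, hF, h⟩ := transitionSum_eq_comp_frestrictLe hd T
  rw [funext h]
  exact hF.comp (measurable_frestrictLe T)

/-- Markov's inequality for the exponential moment gives geometrically decaying tails, so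
Borel–Cantelli applies. -/
theorem ae_eventually_transitionSum_lt (hd : ∀ t, Measurable (Function.uncurry (d t))) {C e : ℝ}
    (hb : ∀ t y x, |d t y x| ≤ C) (h0 : ∀ t y, ∫ x, d t y x ∂κ t y = 0) (he : 0 < e) (heC : e ≤ C)
    (x₀ : ∀ i : Finset.Iic 0, X i) :
    ∀ᵐ ω ∂traj κ 0 x₀, ∀ᶠ T : ℕ in atTop, transitionSum d T ω < e * T := by
  have hC : 0 < C := he.trans_le heC
  -- The minimizer of `l ^ 2 * C ^ 2 - l * e`, with minimum `-l * e / 2 < 0`; `e ≤ C` keeps `l * C ≤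
  -- 1`.
  set l : ℝ := e / (2 * C ^ 2) with hl
  have hl0 : 0 < l := by positivity
  have hlC : |l| * C ≤ 1 := by
    rw [abs_of_pos hl0, hl, div_mul_eq_mul_div, div_le_one (by positivity)]
    nlinarith
  set q : ℝ := Real.exp (l ^ 2 * C ^ 2 - l * e) with hq
  have hq1 : q < 1 := by
    rw [hq, Real.exp_lt_one_iff]
    have : l ^ 2 * C ^ 2 = l * e / 2 := by
      rw [hl]; field_simp
    nlinarith [mul_pos hl0 he]
  have hbound : ∀ T : ℕ, traj κ 0 x₀ {ω | e * T ≤ transitionSum d T ω} ≤ ENNReal.ofReal q ^ T := by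
    intro T
    have hm : Measurable fun ω => ENNReal.ofReal (Real.exp (l * transitionSum d T ω)) :=
      (((measurable_transitionSum hd T).const_mul l).exp).ennreal_ofReal
    have h1 := mul_meas_ge_le_lintegral (μ := traj κ 0 x₀) hm
      (ENNReal.ofReal (Real.exp (l * (e * T))))
    have h2 := h1.trans (lintegral_exp_transitionSum_le hd hb h0 hlC x₀ T)
    have h3 : {ω | e * T ≤ transitionSum d T ω} ⊆ {ω | ENNReal.ofReal (Real.exp (l * (e * T))) ≤
        ENNReal.ofReal (Real.exp (l * transitionSum d T ω))} := fun ω hω =>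
      ENNReal.ofReal_le_ofReal (Real.exp_le_exp.2 (mul_le_mul_of_nonneg_left hω hl0.le))
    have h4 : ENNReal.ofReal q ^ T = ENNReal.ofReal (Real.exp (-(l * (e * T)))) *
        ENNReal.ofReal (Real.exp (l ^ 2 * C ^ 2)) ^ T := by
      rw [← ENNReal.ofReal_pow (Real.exp_pos _).le, ← ENNReal.ofReal_pow (Real.exp_pos _).le,
        ← ENNReal.ofReal_mul (Real.exp_pos _).le, ← Real.exp_nat_mul, ← Real.exp_nat_mul,
        ← Real.exp_add]
      congr 2
      ring
    have h5 : ENNReal.ofReal (Real.exp (-(l * (e * T)))) *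
        ENNReal.ofReal (Real.exp (l * (e * T))) = 1 := by
      rw [← ENNReal.ofReal_mul (Real.exp_pos _).le, ← Real.exp_add]
      simp
    rw [h4]
    refine (measure_mono h3).trans ?_
    calc _ = _ := (one_mul _).symm
      _ ≤ _ := by
        rw [← h5, mul_assoc]
        gcongr
  have hsum : ∑' T : ℕ, traj κ 0 x₀ {ω | e * T ≤ transitionSum d T ω} ≠ ⊤ := by
    refine ne_top_of_le_ne_top ?_ (ENNReal.tsum_le_tsum hbound)
    rw [ENNReal.tsum_geometric]
    simpa [tsub_eq_zero_iff_le] using hq1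
  filter_upwards [ae_eventually_notMem hsum] with ω hω
  filter_upwards [hω] with T hT
  simpa using hT

/-- **Strong law of large numbers** for bounded martingale differences along the trajectories
of an Ionescu-Tulcea process. -/
theorem ae_tendsto_transitionSum_div (hd : ∀ t, Measurable (Function.uncurry (d t))) {C : ℝ}
    (hb : ∀ t y x, |d t y x| ≤ C) (h0 : ∀ t y, ∫ x, d t y x ∂κ t y = 0)
    (x₀ : ∀ i : Finset.Iic 0, X i) :
    ∀ᵐ ω ∂traj κ 0 x₀, Tendsto (fun T : ℕ => transitionSum d T ω / T) atTop (𝓝 0) := by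
  -- `C` need not be positive; `B` is, so every `B / (m + 1)` is an admissible deviation rate.
  set B : ℝ := max C 1
  have hB : 0 < B := lt_max_of_lt_right one_pos
  have he : ∀ m : ℕ, 0 < B / (m + 1) := fun m => by positivity
  have heB : ∀ m : ℕ, B / (m + 1) ≤ B := fun m => div_le_self hB.le (by linarith [m.cast_nonneg (α := ℝ)])
  have hb' : ∀ t y x, |d t y x| ≤ B := fun t y x => (hb t y x).trans (le_max_left _ _)
  have hneg : ∀ T ω, transitionSum (fun t y x => -d t y x) T ω = -transitionSum d T ω := by
    intro T ω
    simp [transitionSum]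
  have h1 := ae_all_iff.2 fun m : ℕ =>
    ae_eventually_transitionSum_lt hd hb' h0 (he m) (heB m) x₀
  have h2 := ae_all_iff.2 fun m : ℕ =>
    ae_eventually_transitionSum_lt (κ := κ) (d := fun t y x => -d t y x) (fun t => (hd t).neg)
      (by simpa using hb') (fun t y => by rw [integral_neg, h0, neg_zero]) (he m) (heB m) x₀
  filter_upwards [h1, h2] with ω h1 h2
  rw [Metric.tendsto_nhds]
  intro e he'
  obtain ⟨m, hm⟩ := exists_nat_gt (B / e)
  have hme : B / (m + 1) < e := by
    rw [div_lt_iff₀ (by positivity)]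
    rw [div_lt_iff₀ he'] at hm
    nlinarith
  filter_upwards [h1 m, h2 m, eventually_gt_atTop 0] with T h1 h2 hT
  have hT' : (0 : ℝ) < T := by exact_mod_cast hT
  rw [hneg] at h2
  rw [Real.dist_eq, sub_zero, abs_lt, lt_div_iff₀ hT', div_lt_iff₀ hT']
  constructor <;> nlinarith

end ProbabilityTheory.Kernel

/-! ### Extending strictly monotone functions -/

/-- A strictly monotone function on a finite set of reals extends to a strictly monotone function
on the real line. -/
theorem StrictMonoOn.exists_strictMono_extension {f : ℝ → ℝ} {s : Set ℝ} (hf : StrictMonoOn f s)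
    (hs : s.Finite) : ∃ g : ℝ → ℝ, StrictMono g ∧ Set.EqOn f g s := by
  -- Finiteness of `s` provides one slope `k > 0` below all difference quotients of `f`. Then `f v -
  -- k * v` is still monotone on `s`; a monotone extension plus `k * v` is strictly monotone.
  have h1 : ∀ q ∈ s ×ˢ s, ∀ᶠ k : ℝ in 𝓝[>] 0, q.1 < q.2 → k * (q.2 - q.1) < f q.2 - f q.1 := by
    rintro ⟨a, b⟩ ⟨ha, hb⟩
    by_cases hab : a < b
    · have h : Tendsto (fun k : ℝ => k * (b - a)) (𝓝[>] 0) (𝓝 0) := by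
        have : Tendsto (fun k : ℝ => k * (b - a)) (𝓝 0) (𝓝 (0 * (b - a))) :=
          (continuous_id.mul continuous_const).tendsto 0
        rw [zero_mul] at this
        exact this.mono_left nhdsWithin_le_nhds
      filter_upwards [h.eventually_lt_const (sub_pos.2 (hf ha hb hab))] with k hk _ using hk
    · exact Eventually.of_forall fun k h => absurd h hab
  obtain ⟨k, hk, hk0⟩ :=
    (((eventually_all_finite (hs.prod hs)).2 h1).and self_mem_nhdsWithin).exists
  have hmono : MonotoneOn (fun v => f v - k * v) s := by
    intro a ha b hb hab
    rcases hab.eq_or_lt with rfl | hab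
    · exact le_rfl
    · have := hk (a, b) ⟨ha, hb⟩ hab
      dsimp only at this ⊢
      linarith
  obtain ⟨g, hg, hgs⟩ := hmono.exists_monotone_extension (hs.image _).bddBelow (hs.image _).bddAbove
  refine ⟨fun v => g v + k * v, hg.add_strictMono fun a b hab => ?_, fun v hv => ?_⟩
  · exact mul_lt_mul_of_pos_left hab hk0
  · simp [← hgs hv]

namespace GraphicalPotential

variable {n : ℕ} {A : Fin n → Type*} {G : SimpleGraph (Fin n)}

/-! ### Hammersley–Clifford theorem -/

section HammersleyClifford

theorem IsGibbsPotential.add {Φ Ψ : Joint A → ℝ} (hΦ : IsGibbsPotential G Φ)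
    (hΨ : IsGibbsPotential G Ψ) : IsGibbsPotential G fun x => Φ x + Ψ x := by
  obtain ⟨φ, hφ⟩ := hΦ
  obtain ⟨ψ, hψ⟩ := hΨ
  exact ⟨fun C z => φ C z + ψ C z, fun x => by simp_rw [hφ, hψ, Finset.sum_add_distrib]⟩

theorem IsGibbsPotential.sub {Φ Ψ : Joint A → ℝ} (hΦ : IsGibbsPotential G Φ)
    (hΨ : IsGibbsPotential G Ψ) : IsGibbsPotential G fun x => Φ x - Ψ x := by
  obtain ⟨φ, hφ⟩ := hΦ
  obtain ⟨ψ, hψ⟩ := hΨ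
  exact ⟨fun C z => φ C z - ψ C z, fun x => by simp_rw [hφ, hψ, Finset.sum_sub_distrib]⟩

open Classical in
/-- The joint action that agrees with `x` on `S` and with `z` off `S`. -/
noncomputable def splice (z : Joint A) (S : Finset (Fin n)) (x : Joint A) : Joint A :=
  fun i => if i ∈ S then x i else z i

/-- The function sees only the actions in `S`, so it can serve as the local potential of a single
maximal clique containing `S`. -/
theorem IsGibbsPotential.of_isClique {S : Finset (Fin n)} (hS : G.IsClique (S : Set (Fin n)))
    (z : Joint A) (Ψ : Joint A → ℝ) : IsGibbsPotential G fun x => Ψ (splice z S x) := by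
  classical
  obtain ⟨C, hSC, hC⟩ := (Set.toFinite {s : Finset (Fin n) |
    G.IsClique (s : Set (Fin n))}).exists_le_maximal hS
  refine ⟨fun D y => if C = D then Ψ (splice z S fun i => if h : i ∈ D then y ⟨i, h⟩ else z i)
    else 0, fun x => ?_⟩
  rw [Finset.sum_ite_eq, if_pos (by simpa using hC)]
  refine congrArg Ψ (funext fun i => ?_)
  by_cases h : i ∈ S
  · simp [splice, h, hSC h]
  · simp [splice, h]

/-- The dependence of `Ψ` on the action of each player `i` is determined by the actions of the
neighbors of `i`. -/
def HasLocalDifferences (G : SimpleGraph (Fin n)) (Ψ : Joint A → ℝ) : Prop :=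
  ∀ (i : Fin n) (x y : Joint A) (a b : A i), x.nbrs G i = y.nbrs G i →
    Ψ (Function.update x i a) - Ψ (Function.update x i b) =
      Ψ (Function.update y i a) - Ψ (Function.update y i b)

/-- **Hammersley–Clifford theorem**, in additive form. -/
theorem HasLocalDifferences.isGibbsPotential {Ψ : Joint A → ℝ} (h : HasLocalDifferences G Ψ)
    (z : Joint A) : IsGibbsPotential G Ψ := by
  classical
  suffices key : ∀ S : Finset (Fin n), IsGibbsPotential G fun x => Ψ (splice z S x) by
    convert key Finset.univ using 3 with x
    ext i
    simp [splice]
  intro S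
  induction S using Finset.strongInduction with
  | H S ih =>
    by_cases hS : G.IsClique (S : Set (Fin n))
    · exact .of_isClique hS z Ψ
    · obtain ⟨i, hi, j, hj, hij, hadj⟩ : ∃ i ∈ S, ∃ j ∈ S, i ≠ j ∧ ¬ G.Adj i j := by
        simpa [SimpleGraph.isClique_iff, Set.Pairwise] using hS
      have hSi := Finset.erase_ssubset hi
      have hSj := Finset.erase_ssubset hj
      have hSij : (S.erase j).erase i ⊂ S :=
        (Finset.erase_ssubset (Finset.mem_erase.2 ⟨hij, hi⟩)).trans hSj
      -- Inclusion–exclusion: as `j` is not a neighbor of `i`, moving `i` from `z i` to `x i`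
      -- changes `Ψ` equally whether `j` plays `x j` or `z j`.
      convert ((ih _ hSi).add (ih _ hSj)).sub (ih _ hSij) using 2 with x
      have e : ∀ T : Finset (Fin n), i ∈ T →
          Function.update (splice z (T.erase i) x) i (x i) = splice z T x := by
        intro T hT
        ext k
        by_cases hk : k = i
        · subst hk; simp [splice, hT]
        · simp [splice, hk]
      have e' : ∀ T : Finset (Fin n),
          Function.update (splice z (T.erase i) x) i (z i) = splice z (T.erase i) x := by
        intro T
        ext k
        by_cases hk : k = i
        · subst hk; simp [splice]
        · simp [hk]
      have := h i (splice z (S.erase i) x) (splice z ((S.erase j).erase i) x) (x i) (z i) (by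
        ext k
        have hkj : (k : Fin n) ≠ j := fun hk => hadj (hk ▸ k.2)
        simp [Joint.nbrs, splice, hkj])
      rw [e S hi, e _ (Finset.mem_erase.2 ⟨hij, hi⟩), e', e'] at this
      linarith

end HammersleyClifford

/-! ### Softmax responses and the Gibbs sampler -/

section Sampler

/-- The probability distribution on a finite type with weights proportional to `exp u`. -/
noncomputable def softmax {α : Type*} [Fintype α] [Nonempty α] (u : α → ℝ) : PMF α :=
  PMF.ofFintype (fun a => ENNReal.ofReal (Real.exp (u a) / ∑ b, Real.exp (u b))) <| by
    have h : 0 < ∑ b, Real.exp (u b) :=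
      Finset.sum_pos (fun b _ => Real.exp_pos _) Finset.univ_nonempty
    rw [← ENNReal.ofReal_sum_of_nonneg fun a _ => by positivity, ← Finset.sum_div, div_self h.ne',
      ENNReal.ofReal_one]

theorem softmax_toReal {α : Type*} [Fintype α] [Nonempty α] (u : α → ℝ) (a : α) :
    (softmax u a).toReal = Real.exp (u a) / ∑ b, Real.exp (u b) :=
  ENNReal.toReal_ofReal (by positivity)

theorem softmax_toReal_div {α : Type*} [Fintype α] [Nonempty α] (u : α → ℝ) (a b : α) :
    (softmax u a).toReal / (softmax u b).toReal = Real.exp (u a - u b) := by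
  have h : 0 < ∑ b, Real.exp (u b) :=
    Finset.sum_pos (fun b _ => Real.exp_pos _) Finset.univ_nonempty
  rw [softmax_toReal, softmax_toReal, div_div_div_cancel_right₀ h.ne', Real.exp_sub]

/-- `V` is a family of local utilities with the same payoff differences as `Ψ`. -/
def IsLocalUtility (V : ∀ i, A i → Nbrs A G i → ℝ) (Ψ : Joint A → ℝ) : Prop :=
  ∀ (i : Fin n) (x : Joint A) (a b : A i), V i a (x.nbrs G i) - V i b (x.nbrs G i) =
    Ψ (Function.update x i a) - Ψ (Function.update x i b)

theorem IsLocalUtility.hasLocalDifferences {V : ∀ i, A i → Nbrs A G i → ℝ} {Ψ : Joint A → ℝ}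
    (h : IsLocalUtility V Ψ) : HasLocalDifferences G Ψ := fun i x y a b hxy => by
  rw [← h i x, ← h i y, hxy]

theorem exists_nbrs_eq [∀ i, Nonempty (A i)] (i : Fin n) (y : Nbrs A G i) : ∃ x : Joint A, x.nbrs G i = y := by
  classical
  exact ⟨fun j => if h : G.Adj i j then y ⟨j, h⟩ else Classical.arbitrary _,
    funext fun j => by simp [Joint.nbrs, j.2]⟩

/-- Each player draws its action from the conditional distribution, given the actions of the
others, of the distribution proportional to `exp Ψ`. -/
def IsGibbsSampler [∀ i, Fintype (A i)] (p : MarkovProcedure A) (Ψ : Joint A → ℝ) : Prop :=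
  ∀ (i : Fin n) (x : Joint A) (a : A i), (p i (x.others i) a).toReal =
    Real.exp (Ψ (Function.update x i a)) / ∑ b, Real.exp (Ψ (Function.update x i b))

variable [∀ i, Fintype (A i)] [∀ i, Nonempty (A i)]

/-- The procedure in which each player responds to its neighbors by the softmax of its utility. -/
noncomputable def softmaxProcedure (V : ∀ i, A i → Nbrs A G i → ℝ) : MarkovProcedure A :=
  fun i y => softmax fun a => V i a (y.nbrs G)

theorem isLocal_softmaxProcedure (V : ∀ i, A i → Nbrs A G i → ℝ) :
    IsLocal G (softmaxProcedure V) :=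
  fun i => ⟨fun y => softmax fun a => V i a y, fun _ => rfl⟩

/-- As functions of the mover's action, `V i` and `Ψ` differ by a constant, which cancels in the
softmax. -/
theorem IsLocalUtility.isGibbsSampler {V : ∀ i, A i → Nbrs A G i → ℝ} {Ψ : Joint A → ℝ}
    (h : IsLocalUtility V Ψ) : IsGibbsSampler (softmaxProcedure V) Ψ := by
  intro i x a
  have e : (x.others i).nbrs G = x.nbrs G i := rfl
  have hV : ∀ b, Real.exp (V i b (x.nbrs G i)) =
      Real.exp (V i a (x.nbrs G i) - Ψ (Function.update x i a)) *
        Real.exp (Ψ (Function.update x i b)) := fun b => by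
    rw [← Real.exp_add]
    congr 1
    linarith [h i x a b]
  rw [softmaxProcedure, softmax_toReal, e]
  simp_rw [hV]
  rw [← Finset.mul_sum, mul_div_mul_left _ _ (Real.exp_pos _).ne']

theorem gibbs_pos (Ψ : Joint A → ℝ) (x : Joint A) : 0 < gibbs Ψ x :=
  div_pos (Real.exp_pos _) (Finset.sum_pos (fun _ _ => Real.exp_pos _) Finset.univ_nonempty)

theorem sum_gibbs (Ψ : Joint A → ℝ) : ∑ x, gibbs Ψ x = 1 := by
  have h : 0 < ∑ x : Joint A, Real.exp (Ψ x) :=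
    Finset.sum_pos (fun _ _ => Real.exp_pos _) Finset.univ_nonempty
  simp_rw [gibbs]
  rw [← Finset.sum_div, div_self h.ne']

theorem gibbs_mem_stdSimplex (Ψ : Joint A → ℝ) : gibbs Ψ ∈ stdSimplex ℝ (Joint A) :=
  ⟨fun x => (gibbs_pos Ψ x).le, sum_gibbs Ψ⟩

end Sampler

end GraphicalPotential

theorem ProbabilityTheory.Kernel.ae_traj_succ {X : ℕ → Type*} [∀ t, MeasurableSpace (X t)]
    {κ : (t : ℕ) → Kernel (∀ i : Finset.Iic t, X i) (X (t + 1))} [∀ t, IsMarkovKernel (κ t)]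
    (x₀ : ∀ i : Finset.Iic 0, X i) (t : ℕ) {q : (∀ i : Finset.Iic t, X i) → X (t + 1) → Prop}
    (hq : MeasurableSet {z : (∀ i : Finset.Iic t, X i) × X (t + 1) | q z.1 z.2})
    (h : ∀ y, ∀ᵐ x ∂κ t y, q y x) :
    ∀ᵐ ω ∂traj κ 0 x₀, q (Preorder.frestrictLe t ω) (ω (t + 1)) := by
  have h1 : ∀ᵐ z ∂(partialTraj κ 0 t x₀) ⊗ₘ (κ t), q z.1 z.2 :=
    (Measure.ae_compProd_iff hq).2 (ae_of_all _ h)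
  rw [partialTraj_compProd_eq_map_traj (Nat.zero_le t)] at h1
  exact ae_of_ae_map (f := fun ω : ∀ t, X t => (Preorder.frestrictLe t ω, ω (t + 1)))
    (by fun_prop) h1

theorem PMF.sum_toReal {α : Type*} [Fintype α] (p : PMF α) : ∑ a, (p a).toReal = 1 := by
  have h := p.tsum_coe
  rw [tsum_fintype] at h
  rw [← ENNReal.toReal_sum fun a _ => p.apply_ne_top a, h, ENNReal.toReal_one]

namespace GraphicalPotential

variable {n : ℕ} {A : Fin n → Type*} [∀ i, Fintype (A i)]

/-! ### Invariance, maximum principle and Poisson equation -/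

section Operators

variable (p : MarkovProcedure A)

/-- The expected value of `u` after player `i` has moved, as a function of the joint action before
the move. -/
noncomputable def respond (i : Fin n) : (Joint A → ℝ) →ₗ[ℝ] (Joint A → ℝ) where
  toFun u x := ∑ a, (p i (x.others i) a).toReal * u (Function.update x i a)
  map_add' u v := by
    ext x
    simp [mul_add, Finset.sum_add_distrib]
  map_smul' c u := by
    ext x
    simp [Finset.mul_sum, mul_left_comm]

/-- The expected value of `u` after the players in the list `l` have moved in order. -/
noncomputable def respondList : List (Fin n) → (Joint A → ℝ) →ₗ[ℝ] (Joint A → ℝ)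
  | [] => LinearMap.id
  | i :: l => respond p i ∘ₗ respondList l

variable {p}

theorem respond_le {i : Fin n} {u : Joint A → ℝ} {m : ℝ} (hu : ∀ x, u x ≤ m) (x : Joint A) :
    respond p i u x ≤ m :=
  calc ∑ a, (p i (x.others i) a).toReal * u (Function.update x i a)
      ≤ ∑ a, (p i (x.others i) a).toReal * m :=
        Finset.sum_le_sum fun a _ => mul_le_mul_of_nonneg_left (hu _) ENNReal.toReal_nonneg
    _ = m := by rw [← Finset.sum_mul, PMF.sum_toReal, one_mul]

theorem respondList_le {l : List (Fin n)} {u : Joint A → ℝ} {m : ℝ} (hu : ∀ x, u x ≤ m)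
    (x : Joint A) : respondList p l u x ≤ m := by
  induction l generalizing x with
  | nil => exact hu x
  | cons i l ih => exact respond_le ih x

theorem abs_respond_le {i : Fin n} {u : Joint A → ℝ} {m : ℝ} (hu : ∀ x, |u x| ≤ m) (x : Joint A) :
    |respond p i u x| ≤ m := by
  refine abs_le'.2 ⟨respond_le (fun x => (le_abs_self _).trans (hu x)) x, ?_⟩
  have := respond_le (p := p) (i := i) (u := -u) (fun x => (neg_le_abs _).trans (hu x)) x
  rwa [map_neg] at this

theorem abs_respondList_le {l : List (Fin n)} {u : Joint A → ℝ} {m : ℝ} (hu : ∀ x, |u x| ≤ m)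
    (x : Joint A) : |respondList p l u x| ≤ m := by
  induction l generalizing x with
  | nil => exact hu x
  | cons i l ih => exact abs_respond_le ih x

/-- The strong maximum principle for a single move. -/
theorem eq_of_respond_eq (hp : ∀ i y a, 0 < (p i y a).toReal) {i : Fin n} {u : Joint A → ℝ}
    {m : ℝ} (hu : ∀ x, u x ≤ m) {x : Joint A} (h : respond p i u x = m) (a : A i) :
    u (Function.update x i a) = m := by
  have h1 : ∑ b, (p i (x.others i) b).toReal * u (Function.update x i b) =
      ∑ b, (p i (x.others i) b).toReal * m := by
    rw [← Finset.sum_mul, PMF.sum_toReal, one_mul]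
    exact h
  have h2 := (Finset.sum_eq_sum_iff_of_le fun b _ =>
    mul_le_mul_of_nonneg_left (hu _) ENNReal.toReal_nonneg).1 h1 a (Finset.mem_univ a)
  exact mul_left_cancel₀ (hp _ _ _).ne' h2

/-- The strong maximum principle for a list of moves. -/
theorem eq_of_respondList_eq (hp : ∀ i y a, 0 < (p i y a).toReal) {l : List (Fin n)}
    {u : Joint A → ℝ} {m : ℝ} (hu : ∀ x, u x ≤ m) {x y : Joint A} (h : respondList p l u x = m)
    (hxy : ∀ j, j ∉ l → y j = x j) : u y = m := by
  induction l generalizing x with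
  | nil => rwa [funext fun j => hxy j List.not_mem_nil]
  | cons i l ih =>
    -- The maximum is also attained after `i` switches to `y i`, which brings coordinate `i` into
    -- agreement with `y`.
    refine ih (eq_of_respond_eq hp (respondList_le hu) h (y i)) fun j hj => ?_
    by_cases hji : j = i
    · subst hji
      simp
    · rw [Function.update_of_ne hji]
      exact hxy j (by simp [hji, hj])

variable {Ψ : Joint A → ℝ}

/-- The distribution proportional to `exp Ψ` is invariant under a move of the Gibbs sampler. -/
theorem IsGibbsSampler.sum_gibbs_mul_respond (h : IsGibbsSampler p Ψ) (i : Fin n)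
    (u : Joint A → ℝ) : ∑ x, gibbs Ψ x * respond p i u x = ∑ x, gibbs Ψ x * u x := by
  set W : Joint A → A i → ℝ := fun x a => gibbs Ψ x * (p i (x.others i) a).toReal with hW
  -- Detailed balance: both sides carry the weights of the two states, over the same normalizing
  -- sums.
  have hswap : ∀ x a, W x a = W (Function.update x i a) (x i) := by
    intro x a
    simp only [hW]
    rw [h, h]
    simp only [gibbs, Function.update_idem, Function.update_eq_self]
    ring
  calc ∑ x, gibbs Ψ x * respond p i u x
      = ∑ q : Joint A × A i, W q.1 q.2 * u (Function.update q.1 i q.2) := by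
        rw [Fintype.sum_prod_type]
        refine Finset.sum_congr rfl fun x _ => ?_
        simp only [respond, LinearMap.coe_mk, AddHom.coe_mk, Finset.mul_sum, hW, mul_assoc]
    _ = ∑ q : Joint A × A i, W q.1 q.2 * u q.1 := by
        refine Finset.sum_nbij' (fun q => (Function.update q.1 i q.2, q.1 i))
          (fun q => (Function.update q.1 i q.2, q.1 i)) ?_ ?_ ?_ ?_ ?_
        · simp
        · simp
        · simp
        · simp
        · intro q _
          dsimp only
          rw [← hswap]
    _ = ∑ x, gibbs Ψ x * u x := by
        rw [Fintype.sum_prod_type]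
        refine Finset.sum_congr rfl fun x _ => ?_
        simp only [hW]
        rw [← Finset.sum_mul, ← Finset.mul_sum, PMF.sum_toReal, mul_one]

theorem IsGibbsSampler.sum_gibbs_mul_respondList (h : IsGibbsSampler p Ψ) (l : List (Fin n))
    (u : Joint A → ℝ) : ∑ x, gibbs Ψ x * respondList p l u x = ∑ x, gibbs Ψ x * u x := by
  induction l with
  | nil => rfl
  | cons i l ih => exact (h.sum_gibbs_mul_respond i _).trans ih

variable [∀ i, Nonempty (A i)]

theorem IsGibbsSampler.toReal_pos (h : IsGibbsSampler p Ψ) (i : Fin n) (y : Others A i) (a : A i) :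
    0 < (p i y a).toReal := by
  obtain ⟨x, rfl⟩ : ∃ x : Joint A, x.others i = y := by
    classical
    exact ⟨fun j => if hj : j ≠ i then y ⟨j, hj⟩ else Classical.arbitrary _,
      funext fun j => by simp [Joint.others, j.2]⟩
  rw [h]
  exact div_pos (Real.exp_pos _) (Finset.sum_pos (fun _ _ => Real.exp_pos _) Finset.univ_nonempty)

/-- The Poisson equation for a round of the Gibbs sampler is solvable. -/
theorem IsGibbsSampler.exists_poisson (h : IsGibbsSampler p Ψ) (φ : Joint A → ℝ) :
    ∃ g : Joint A → ℝ, ∀ x, g x - respondList p (List.finRange n) g x =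
      φ x - ∑ y, gibbs Ψ y * φ y := by
  let E : (Joint A → ℝ) →ₗ[ℝ] (Joint A → ℝ) :=
    { toFun := fun f _ => ∑ y, gibbs Ψ y * f y
      map_add' := fun f g => by
        ext x
        simp [mul_add, Finset.sum_add_distrib]
      map_smul' := fun c f => by
        ext x
        simp [Finset.mul_sum, mul_left_comm] }
  have hE : ∀ f x, E f x = ∑ y, gibbs Ψ y * f y := fun _ _ => rfl
  -- Adding the mean `E` removes the constants from the kernel of `id - K`, so in finite dimension
  -- `L` is bijective once injective.
  let L := LinearMap.id - respondList p (List.finRange n) + E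
  have hL : ∀ f x, L f x = f x - respondList p (List.finRange n) f x + ∑ y, gibbs Ψ y * f y :=
    fun _ _ => rfl
  have hEL : ∀ f, ∑ x, gibbs Ψ x * L f x = ∑ x, gibbs Ψ x * f x := by
    intro f
    simp_rw [hL, mul_add, mul_sub]
    rw [Finset.sum_add_distrib, Finset.sum_sub_distrib, h.sum_gibbs_mul_respondList,
      ← Finset.sum_mul, sum_gibbs]
    ring
  have hinj : Function.Injective L := by
    refine (injective_iff_map_eq_zero L).2 fun f hf => ?_
    have h0 : ∑ x, gibbs Ψ x * f x = 0 := by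
      rw [← hEL, hf]
      simp
    have hfix : ∀ x, respondList p (List.finRange n) f x = f x := fun x => by
      have := hL f x
      rw [hf, h0] at this
      simp only [Pi.zero_apply] at this
      linarith
    obtain ⟨x, hx⟩ := Finite.exists_max f
    -- Every player moves in a round, so any `y` is reachable from the maximizer `x`.
    have hconst : ∀ y, f y = f x := fun y =>
      eq_of_respondList_eq h.toReal_pos hx (hfix x) fun j hj => absurd (List.mem_finRange j) hj
    have : f x = 0 := by
      rw [← h0]
      simp_rw [hconst]
      rw [← Finset.sum_mul, sum_gibbs, one_mul]
    ext y
    rw [hconst, this, Pi.zero_apply]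
  obtain ⟨g, hg⟩ := (LinearMap.injective_iff_surjective.1 hinj) (fun x => φ x - ∑ y, gibbs Ψ y * φ y)
  -- Since `E ∘ L = E` and the right-hand side has mean zero, so does `g`, and the extra term of `L`
  -- vanishes.
  have hg0 : ∑ x, gibbs Ψ x * g x = 0 := by
    rw [← hEL, hg]
    simp_rw [mul_sub]
    rw [Finset.sum_sub_distrib, ← Finset.sum_mul, sum_gibbs]
    ring
  refine ⟨g, fun x => ?_⟩
  have := hL g x
  rw [hg, hg0] at this
  linarith

end Operators

end GraphicalPotential

namespace GraphicalPotential

variable {n : ℕ} {A : Fin n → Type*}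

/-! ### Almost sure convergence of empirical play -/

section Convergence

/-- The player who moves at the step from time `t` to time `t + 1`. -/
def mover (hn : 0 < n) (t : ℕ) : Fin n := ⟨t % n, Nat.mod_lt t hn⟩

theorem playStep_of_pos (hn : 0 < n) (p : MarkovProcedure A) (t : ℕ) (x : Joint A) :
    playStep p t x =
      (p (mover hn t) (x.others _)).map (Function.update x (mover hn t)) :=
  dif_pos hn

theorem mover_mul_add (hn : 0 < n) (r : ℕ) {j : ℕ} (hj : j < n) :
    mover hn (r * n + j) = ⟨j, hj⟩ := by
  ext
  simp [mover, Nat.mod_eq_of_lt hj]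

variable [∀ i, Fintype (A i)]

/-- The expected value of `g` at the end of a round in which the players before `j` have already
moved. -/
noncomputable def roundValue (p : MarkovProcedure A) (g : Joint A → ℝ) (j : ℕ) : Joint A → ℝ :=
  respondList p ((List.finRange n).drop j) g

theorem roundValue_eq_respond (p : MarkovProcedure A) (g : Joint A → ℝ) {j : ℕ} (hj : j < n) :
    roundValue p g j = respond p ⟨j, hj⟩ (roundValue p g (j + 1)) := by
  rw [roundValue, List.drop_eq_getElem_cons (by simpa using hj)]
  simp [respondList, roundValue]

/-- The martingale differences of the conditional expectations of `g` at the end of the round. -/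
noncomputable def roundDiff (hn : 0 < n) (p : MarkovProcedure A) (g : Joint A → ℝ) (t : ℕ)
    (y : ∀ _ : Finset.Iic t, Joint A) (x : Joint A) : ℝ :=
  roundValue p g (t % n + 1) x -
    respond p (mover hn t) (roundValue p g (t % n + 1)) (y ⟨t, Finset.mem_Iic.2 le_rfl⟩)

/-- Within a round, averaging the value after move `j` over that move gives the value before it, so
the differences telescope. -/
theorem transitionSum_roundDiff (hn : 0 < n) (p : MarkovProcedure A) (g : Joint A → ℝ) (T : ℕ)
    (ω : ℕ → Joint A) :
    Kernel.transitionSum (X := fun _ => Joint A) (roundDiff hn p g) (T * n) ω =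
      ∑ r ∈ Finset.range T,
        (g (ω ((r + 1) * n)) - respondList p (List.finRange n) g (ω (r * n))) := by
  induction T with
  | zero => simp [Kernel.transitionSum]
  | succ T ih =>
    rw [Finset.sum_range_succ, ← ih, add_mul, one_mul, Kernel.transitionSum, Finset.sum_range_add]
    congr 1
    have hj : ∀ j ∈ Finset.range n,
        roundDiff hn p g (T * n + j) (Preorder.frestrictLe (π := fun _ => Joint A) (T * n + j) ω)
          (ω (T * n + j + 1)) =
        roundValue p g (j + 1) (ω (T * n + (j + 1))) - roundValue p g j (ω (T * n + j)) := by
      intro j hj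
      have hjn := Finset.mem_range.1 hj
      rw [roundDiff, mover_mul_add hn T hjn, roundValue_eq_respond p g hjn,
        Nat.mul_add_mod_self_right, Nat.mod_eq_of_lt hjn]
      rfl
    rw [Finset.sum_congr rfl hj,
      Finset.sum_range_sub fun j => roundValue p g j (ω (T * n + j))]
    simp [roundValue, List.drop_of_length_le, respondList]

variable [∀ i, MeasurableSpace (A i)] [∀ i, MeasurableSingletonClass (A i)]

theorem integral_playStep (hn : 0 < n) (p : MarkovProcedure A) (t : ℕ) (x : Joint A)
    (u : Joint A → ℝ) : ∫ y, u y ∂(playStep p t x).toMeasure = respond p (mover hn t) u x := by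
  rw [playStep_of_pos hn, ← PMF.toMeasure_map _ _ (measurable_of_finite _),
    integral_map (measurable_of_finite _).aemeasurable
      (measurable_of_finite u).aestronglyMeasurable, PMF.integral_eq_sum]
  rfl

theorem ae_playStep (hn : 0 < n) (p : MarkovProcedure A) (t : ℕ) (x : Joint A) :
    ∀ᵐ y ∂(playStep p t x).toMeasure, ∀ j, j ≠ mover hn t → y j = x j := by
  rw [playStep_of_pos hn, ← PMF.toMeasure_map _ _ (measurable_of_finite _),
    ae_map_iff (measurable_of_finite _).aemeasurable (Set.toFinite _).measurableSet]
  exact ae_of_all _ fun a j hj => Function.update_of_ne hj _ _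

theorem playKernel_apply (p : MarkovProcedure A) (t : ℕ) (y : ∀ _ : Finset.Iic t, Joint A) :
    playKernel p t y = (playStep p t (y ⟨t, Finset.mem_Iic.2 le_rfl⟩)).toMeasure :=
  rfl

/-- Almost surely, only the mover changes its action. -/
theorem ae_playLaw_eq_of_ne_mover (hn : 0 < n) (p : MarkovProcedure A) (x₀ : Joint A) :
    ∀ᵐ ω ∂playLaw p x₀, ∀ t j, j ≠ mover hn t → ω (t + 1) j = ω t j := by
  refine ae_all_iff.2 fun t => ?_
  refine Kernel.ae_traj_succ (X := fun _ => Joint A) (κ := playKernel p) (fun _ => x₀) t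
    (q := fun y x => ∀ j, j ≠ mover hn t → x j = y ⟨t, Finset.mem_Iic.2 le_rfl⟩ j)
    (Set.toFinite _).measurableSet fun y => ?_
  rw [playKernel_apply]
  exact ae_playStep hn p t _

/-- Almost surely, the outcome of a round is the state at the end of the round. -/
theorem ae_playLaw_outcome_eq (hn : 0 < n) (p : MarkovProcedure A) (x₀ : Joint A) :
    ∀ᵐ ω ∂playLaw p x₀, ∀ r, outcome ω r = ω ((r + 1) * n) := by
  filter_upwards [ae_playLaw_eq_of_ne_mover hn p x₀] with ω hω r
  ext i
  -- Player `i` acts in the step to time `r * n + i + 1`; the remaining movers of the round have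
  -- larger indices, so its action persists.
  have key : ∀ k, i + 1 + k ≤ n → ω (r * n + (i + 1 + k)) i = ω (r * n + i + 1) i := by
    intro k
    induction k with
    | zero => exact fun _ => rfl
    | succ k ih =>
      intro hk
      rw [← ih (by omega)]
      refine hω (r * n + (i + 1 + k)) i ?_
      rw [mover_mul_add hn r (show (i : ℕ) + 1 + k < n by omega)]
      intro hi
      have := congrArg Fin.val hi
      simp only at this
      omega
  have := key (n - (i + 1)) (by omega)
  rw [show (i : ℕ) + 1 + (n - (i + 1)) = n by omega] at this
  rw [add_mul, one_mul, this]
  rfl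

/-- **Ergodic theorem** for the rounds of the Gibbs sampler. -/
theorem IsGibbsSampler.ae_tendsto_average [∀ i, Nonempty (A i)] {p : MarkovProcedure A}
    {Ψ : Joint A → ℝ} (h : IsGibbsSampler p Ψ) (hn : 0 < n) (x₀ : Joint A) (φ : Joint A → ℝ) :
    ∀ᵐ ω ∂playLaw p x₀, Tendsto
      (fun T : ℕ => (∑ r ∈ Finset.range T, φ (ω ((r + 1) * n))) / T) atTop
      (𝓝 (∑ y, gibbs Ψ y * φ y)) := by
  obtain ⟨g, hg⟩ := h.exists_poisson φ
  set K := respondList p (List.finRange n) g with hK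
  set c := ∑ y, gibbs Ψ y * φ y
  obtain ⟨z, hz⟩ := Finite.exists_max fun x => |g x|
  set B := |g z|
  have hbound : ∀ t y x, |roundDiff hn p g t y x| ≤ B + B := fun t y x =>
    (abs_sub _ _).trans (add_le_add (abs_respondList_le hz x)
      (abs_respond_le (fun x => abs_respondList_le hz x) _))
  have hmeas : ∀ t, Measurable (Function.uncurry (roundDiff hn p g t)) := fun t =>
    ((measurable_of_finite (roundValue p g (t % n + 1))).comp measurable_snd).sub
      ((measurable_of_finite (respond p (mover hn t) (roundValue p g (t % n + 1)))).comp
        ((measurable_pi_apply _).comp measurable_fst))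
  have hzero : ∀ t y, ∫ x, roundDiff hn p g t y x ∂playKernel p t y = 0 := by
    intro t y
    have hint : Integrable (roundValue p g (t % n + 1)) (playKernel p t y) := .of_finite
    simp only [roundDiff]
    rw [integral_sub hint (integrable_const _), integral_const, playKernel_apply,
      integral_playStep hn]
    simp
  have hlaw := Kernel.ae_tendsto_transitionSum_div (X := fun _ => Joint A) (κ := playKernel p)
    hmeas hbound hzero fun _ => x₀
  filter_upwards [hlaw] with ω hω
  -- The strong law counts single moves, the average counts rounds; the factor `n` converts.
  have h1 : Tendsto (fun T : ℕ => Kernel.transitionSum (X := fun _ => Joint A)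
      (roundDiff hn p g) (T * n) ω / ((T * n : ℕ) : ℝ) * n) atTop (𝓝 0) := by
    have := (hω.comp (tendsto_id.atTop_mul_const' hn)).mul_const (n : ℝ)
    rwa [zero_mul] at this
  have h2 : Tendsto (fun T : ℕ => (K (ω 0) - K (ω (T * n))) / T) atTop (𝓝 0) := by
    refine squeeze_zero_norm (fun T => ?_) (tendsto_const_div_atTop_nhds_zero_nat (B + B))
    rw [norm_div, Real.norm_eq_abs, Real.norm_natCast]
    gcongr
    exact (abs_sub _ _).trans (add_le_add (abs_respondList_le hz _) (abs_respondList_le hz _))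
  have h3 := (h1.add h2).const_add c
  rw [add_zero, add_zero] at h3
  refine h3.congr' ?_
  filter_upwards [eventually_gt_atTop 0] with T hT
  have hT' : (T : ℝ) ≠ 0 := by exact_mod_cast hT.ne'
  have hn' : (n : ℝ) ≠ 0 := by exact_mod_cast hn.ne'
  -- Poisson decomposition: martingale part, telescoped boundary term, and `c` once per round.
  have h4 : ∑ r ∈ Finset.range T, φ (ω ((r + 1) * n)) =
      Kernel.transitionSum (X := fun _ => Joint A) (roundDiff hn p g) (T * n) ω +
        (K (ω 0) - K (ω (T * n))) + T * c := by
    have h5 := Finset.sum_range_sub (fun r => K (ω (r * n))) T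
    have h6 : ∑ r ∈ Finset.range T, φ (ω ((r + 1) * n)) = ∑ r ∈ Finset.range T,
        (g (ω ((r + 1) * n)) - K (ω (r * n)) - (K (ω ((r + 1) * n)) - K (ω (r * n))) + c) :=
      Finset.sum_congr rfl fun r _ => by linarith [hg (ω ((r + 1) * n))]
    rw [h6, Finset.sum_add_distrib, Finset.sum_sub_distrib, h5, transitionSum_roundDiff]
    simp
    ring
  rw [h4]
  push_cast
  field_simp
  ring

theorem IsGibbsSampler.playConvergesTo [∀ i, Nonempty (A i)] {p : MarkovProcedure A}
    {Ψ : Joint A → ℝ} (h : IsGibbsSampler p Ψ) (x₀ : Joint A) :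
    PlayConvergesTo p x₀ (gibbs Ψ) := by
  rcases Nat.eq_zero_or_pos n with rfl | hn
  -- With no players there is a single joint action, and both distributions give it mass `1` once `T
  -- > 0`.
  · refine ae_of_all _ fun ω x => ?_
    have h1 : gibbs Ψ x = 1 := by
      rw [← sum_gibbs Ψ, Fintype.sum_subsingleton _ x]
    rw [h1]
    refine tendsto_const_nhds.congr' ?_
    filter_upwards [eventually_gt_atTop 0] with T hT
    have hT' : (T : ℝ) ≠ 0 := by exact_mod_cast hT.ne'
    simp [empirical, Subsingleton.elim _ x, hT']
  · refine ae_all_iff.2 fun x => ?_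
    filter_upwards [ae_playLaw_outcome_eq hn p x₀,
      h.ae_tendsto_average hn x₀ (Set.indicator {x} fun _ => (1 : ℝ))] with ω h1 h2
    simp only [empirical, h1]
    convert h2 using 2
    classical
    simp [Set.indicator_apply]

theorem IsGibbsSampler.isConsistent [∀ i, Nonempty (A i)] {p : MarkovProcedure A}
    {Ψ : Joint A → ℝ} (h : IsGibbsSampler p Ψ) : IsConsistent p :=
  ⟨gibbs Ψ, gibbs_mem_stdSimplex Ψ, h.playConvergesTo⟩

end Convergence

/-! ### Inverse transforms -/

section Transforms

variable {G : SimpleGraph (Fin n)} {M : GraphicalGame A G} {Ψ : Joint A → ℝ}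

theorem IsTransformedPotential.inverse_payoff_sub {f g : Transforms A G} (hgf : IsInverseOf g f)
    (h : IsTransformedPotential M f Ψ) (i : Fin n) (x : Joint A) (a b : A i) :
    g i (M.payoff i a (x.nbrs G i) - M.payoff i b (x.nbrs G i)) (x.nbrs G i) =
      Ψ (Function.update x i a) - Ψ (Function.update x i b) := by
  rw [h, hgf]

/-- An inverse is strictly increasing only on the range of `f i · y` and arbitrary elsewhere. On a
finite subset of that range its values extend to a strictly increasing function; if all these maps
are onto, no change is needed. -/
theorem exists_transforms_extending_inverse {f g : Transforms A G}
    (hf : ∀ i, IsPreferenceOrderPreserving (f i)) (hgf : IsInverseOf g f) (i : Fin n)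
    {D : Nbrs A G i → Set ℝ} (hD : ∀ y, (D y).Finite)
    (hDf : ∀ y, D y ⊆ Set.range fun v => f i v y) :
    ∃ h : ℝ → Nbrs A G i → ℝ, IsPreferenceOrderPreserving h ∧ (∀ y, ∀ v ∈ D y, h v y = g i v y) ∧
      ((∀ y, Function.Surjective fun v => f i v y) → h = g i) := by
  have hmono : ∀ y, StrictMonoOn (fun v => g i v y) (Set.range fun v => f i v y) := by
    rintro y _ ⟨u, rfl⟩ _ ⟨v, rfl⟩ huv
    simpa only [hgf i _ y] using (hf i y).lt_iff_lt.1 huv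
  by_cases hs : ∀ y, Function.Surjective fun v => f i v y
  · refine ⟨g i, fun y => ?_, fun _ _ _ => rfl, fun _ => rfl⟩
    simpa only [(hs y).range_eq, strictMonoOn_univ] using hmono y
  · choose h hh hhg using fun y => ((hmono y).mono (hDf y)).exists_strictMono_extension (hD y)
    exact ⟨fun v y => h y v, hh, fun y v hv => (hhg y hv).symm, fun hs' => absurd hs' hs⟩

end Transforms

end GraphicalPotential

/-! ### Assembly of the proposition -/

open GraphicalPotential
theorem mainTheorem5 {n : ℕ} {A : Fin n → Type*} [∀ i, Fintype (A i)] [∀ i, Nonempty (A i)]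
    [∀ i, MeasurableSpace (A i)] [∀ i, MeasurableSingletonClass (A i)]
    (G : SimpleGraph (Fin n)) (M : GraphicalGame A G) (Ψ : Joint A → ℝ) :
    (∀ f g : Transforms A G, (∀ i, IsPreferenceOrderPreserving (f i)) → IsInverseOf g f →
      IsTransformedPotential M f Ψ →
      IsGibbsPotential G Ψ ∧
      ∃ (p : MarkovProcedure A) (h : Transforms A G),
        IsSBRD M p h ∧
        (∀ i (y : Nbrs A G i) (a b : A i),
          h i (M.payoff i a y - M.payoff i b y) y = g i (M.payoff i a y - M.payoff i b y) y) ∧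
        (∀ i, (∀ y, Function.Surjective fun v => f i v y) → h i = g i) ∧
        IsLocal G p ∧ IsConsistent p ∧ ∀ x₀, PlayConvergesTo p x₀ (gibbs Ψ)) ∧
    (∀ w : Fin n → ℝ, (∀ i, 0 < w i) → IsWeightedPotential M w Ψ →
      IsGibbsPotential G Ψ ∧
      ∃ p : MarkovProcedure A,
        IsSBR M p (linearTransforms A G fun i => 1 / w i) ∧
        IsLocal G p ∧ IsConsistent p ∧ ∀ x₀, PlayConvergesTo p x₀ (gibbs Ψ)) := by
  have z : Joint A := fun i => Classical.arbitrary (A i)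
  constructor
  · intro f g hf hgf hΨ
    choose h hh hhg hhs using fun i => exists_transforms_extending_inverse hf hgf i
      (D := fun y => Set.range fun q : A i × A i => M.payoff i q.1 y - M.payoff i q.2 y)
      (fun y => Set.finite_range _) (by
        rintro y _ ⟨q, rfl⟩
        obtain ⟨x, rfl⟩ := exists_nbrs_eq i y
        exact ⟨_, (hΨ i x q.1 q.2).symm⟩)
    have hhg' : ∀ i (y : Nbrs A G i) (a b : A i), h i (M.payoff i a y - M.payoff i b y) y =
        g i (M.payoff i a y - M.payoff i b y) y := fun i y a b => hhg i y _ ⟨(a, b), rfl⟩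
    -- Payoffs are measured relative to the reference action `z i`, since `g i` is controlled only
    -- on payoff differences; `V i a` is then `Ψ` up to a term independent of `a`.
    let V : ∀ i, A i → Nbrs A G i → ℝ := fun i a y => g i (M.payoff i a y - M.payoff i (z i) y) y
    have hV : IsLocalUtility V Ψ := fun i x a b => by
      simp only [V, hΨ.inverse_payoff_sub hgf]
      ring
    have hS := hV.isGibbsSampler
    refine ⟨hV.hasLocalDifferences.isGibbsPotential z, softmaxProcedure V, h,
      fun i => ⟨hh i, fun y a b => ?_⟩, hhg', hhs, isLocal_softmaxProcedure V, hS.isConsistent,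
      hS.playConvergesTo⟩
    rw [softmaxProcedure, softmax_toReal_div, hhg']
    obtain ⟨x, hx⟩ := exists_nbrs_eq i (y.nbrs G)
    rw [← hx, hV, hΨ.inverse_payoff_sub hgf]
  · intro w hw hΨ
    let V : ∀ i, A i → Nbrs A G i → ℝ := fun i a y => 1 / w i * M.payoff i a y
    have hV : IsLocalUtility V Ψ := fun i x a b => by
      have h1 := hΨ i x a b
      simp only [linearTransforms] at h1
      simp only [V]
      rw [← mul_sub, h1, ← mul_assoc, one_div_mul_cancel (hw i).ne', one_mul]
    have hS := hV.isGibbsSampler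
    refine ⟨hV.hasLocalDifferences.isGibbsPotential z, softmaxProcedure V,
      fun i => ⟨fun y => ?_, fun y => ⟨(∑ b, Real.exp (V i b (y.nbrs G)))⁻¹, fun a => ?_⟩⟩,
      isLocal_softmaxProcedure V, hS.isConsistent, hS.playConvergesTo⟩
    · exact strictMono_mul_left_of_pos (one_div_pos.2 (hw i))
    · rw [softmaxProcedure, softmax_toReal, div_eq_inv_mul]
      rfl
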